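/- Let $K$ be a field of characteristic zero and let $n\ge 1$. Let $B$ be the subgroup of upper triangular matrices in $\mathrm{GL}(n,K)$. The group $\mathrm{GL}(n,K)$ acts on $V=\mathrm{Mat}(n,K)$ by $\mathrm{Ad}_g X=gXg^{-1}$, and on the field $K(V)=K(x_{r,c} : 1\le r,c\le n)$ of rational functions by $(\mathrm{Ad}_g f)(X)=f(g^{-1}Xg)$. Let $K(V)^B$ be the field of $B$-invariant rational functions. Let $X=(x_{r,c})$ be the generic matrix and $X^*$ its adjugate, so that $XX^*=X^*X=\det X\cdot E$. For $1\le i\le n$ and $0\le j\le i-1$ let $J_{i,j}$ be the determinant of the $i\times i$ matrix whose first $i-j$ rows are the last $i-j$ rows of $X$ (rows $n-i+j+1,\dots,n$) and whose last $j$ rows are the last $j$ rows of $X^*$ (rows $n-j+1,\dots,n$), all of them restricted to the first $i$ columns. Put $$y_1=J_{1,0},\qquad y_i=\frac{J_{i,i-1}}{J_{i-1,0}}\quad(2\le i\le n),$$ $$Y_{i,j}=\frac{J_{i,j}\,y_{n-i+j+1}}{J_{i-1,j}\,y_i}\quad(2\le i\le n,\ 0\le j\le i-2).$$ Theorem 2.2.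 All $J_{i,j}$ $(1\le i\le n,\ 0\le j\le i-1)$ are nonzero, so that the $y_i$ and $Y_{i,j}$ are well-defined elements of $K(V)$. The elements $y_n$ and $Y_{i,j}$ $(2\le i\le n,\ 0\le j\le i-2)$ are algebraically independent over $K$, and they generate the field of $B$-invariants: $$K(V)^B=K\bigl(y_n,\ Y_{i,j} : 2\le i\le n,\ 0\le j\le i-2\bigr).$$ -/

import Mathlib

open scoped Matrix MatrixGroups

namespace BorelInvariants

noncomputable section

/-- The algebra `K[V]` of polynomial functions on `V = Mat(n, K)`; the variable `X (r, c)` is the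
coordinate function of the entry in row `r` and column `c` (rows and columns counted from `0`). -/
abbrev PolyFun (n : ℕ) (K : Type*) [Field K] : Type _ := MvPolynomial (Fin n × Fin n) K

/-- The field `K(V)` of rational functions on `V = Mat(n, K)`. -/
abbrev RatFun (n : ℕ) (K : Type*) [Field K] : Type _ := FractionRing (PolyFun n K)

/-- The generic matrix, whose entries are the coordinate functions. -/
abbrev genericMatrix (n : ℕ) (K : Type*) [Field K] : Matrix (Fin n) (Fin n) (PolyFun n K) :=
  Matrix.mvPolynomialX (Fin n) (Fin n) K

/-- The matrix `g⁻¹ X g`, where `X` is the generic matrix. -/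
def conjGeneric (n : ℕ) (K : Type*) [Field K] (g : GL (Fin n) K) :
    Matrix (Fin n) (Fin n) (PolyFun n K) :=
  (g⁻¹ : GL (Fin n) K).val.map MvPolynomial.C * genericMatrix n K * g.val.map MvPolynomial.C

/-- `Ad_g f (X) = f (g⁻¹ X g)` on polynomial functions, as an algebra endomorphism. -/
def adPolyHom (n : ℕ) (K : Type*) [Field K] (g : GL (Fin n) K) : PolyFun n K →ₐ[K] PolyFun n K :=
  MvPolynomial.aeval fun p => conjGeneric n K g p.1 p.2

/-- The defining property of `Ad_g`: the value of `Ad_g f` at a matrix `A` is `f (g⁻¹ A g)`. -/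
theorem eval_adPolyHom (n : ℕ) (K : Type*) [Field K] (g : GL (Fin n) K) (f : PolyFun n K)
    (A : Matrix (Fin n) (Fin n) K) :
    MvPolynomial.eval (fun p => A p.1 p.2) (adPolyHom n K g f) =
      MvPolynomial.eval
        (fun p => ((g⁻¹ : GL (Fin n) K).val * A * g.val : Matrix (Fin n) (Fin n) K) p.1 p.2) f := by
  rw [adPolyHom, MvPolynomial.aeval_def, MvPolynomial.eval_eval₂]
  refine congrArg₂ (fun φ x => MvPolynomial.eval₂ φ x f) ?_ ?_
  · ext a
    simp
  · funext p
    simp [conjGeneric, Matrix.mul_apply, map_sum]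

theorem adPolyHom_one (n : ℕ) (K : Type*) [Field K] : adPolyHom n K 1 = 1 := by
  refine MvPolynomial.algHom_ext fun p => ?_
  have h1 : (1 : Matrix (Fin n) (Fin n) K).map (MvPolynomial.C (σ := Fin n × Fin n)) = 1 :=
    Matrix.map_one _ (map_zero _) (map_one _)
  simp only [adPolyHom, conjGeneric, inv_one, Units.val_one, h1, Matrix.one_mul, Matrix.mul_one,
    MvPolynomial.aeval_X, Matrix.mvPolynomialX_apply, AlgHom.one_apply]

theorem adPolyHom_mul (n : ℕ) (K : Type*) [Field K] (g h : GL (Fin n) K) :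
    adPolyHom n K (g * h) = adPolyHom n K g * adPolyHom n K h := by
  refine MvPolynomial.algHom_ext fun p => ?_
  have hX : (genericMatrix n K).map (adPolyHom n K g) = conjGeneric n K g := by
    ext1 r c
    simp [adPolyHom]
  have hC (A : Matrix (Fin n) (Fin n) K) :
      (A.map MvPolynomial.C).map (adPolyHom n K g) = A.map MvPolynomial.C := by
    ext1 r c
    exact (adPolyHom n K g).commutes (A r c)
  have key : conjGeneric n K (g * h) = (conjGeneric n K h).map (adPolyHom n K g) := by
    rw [conjGeneric, conjGeneric, Matrix.map_mul, Matrix.map_mul, hX, hC, hC, conjGeneric,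
      mul_inv_rev, Units.val_mul, Units.val_mul, Matrix.map_mul, Matrix.map_mul]
    simp only [Matrix.mul_assoc]
  have hp := congrFun (congrFun key p.1) p.2
  simpa [adPolyHom] using hp

/-- The action of `GL(n, K)` on `K[V]` by `Ad_g f (X) = f (g⁻¹ X g)`. -/
def adPoly (n : ℕ) (K : Type*) [Field K] : GL (Fin n) K →* (PolyFun n K ≃ₐ[K] PolyFun n K) :=
  (AlgEquiv.algHomUnitsEquiv K (PolyFun n K)).toMonoidHom.comp
    (MonoidHom.toHomUnits
      ({ toFun := adPolyHom n K
         map_one' := adPolyHom_one n K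
         map_mul' := adPolyHom_mul n K } : GL (Fin n) K →* (PolyFun n K →ₐ[K] PolyFun n K)))

theorem adPoly_apply (n : ℕ) (K : Type*) [Field K] (g : GL (Fin n) K) (f : PolyFun n K) :
    adPoly n K g f = adPolyHom n K g f := rfl

/-- The action of `GL(n, K)` on the field `K(V)` by `Ad_g (p / q) = Ad_g p / Ad_g q`. -/
def adRat (n : ℕ) (K : Type*) [Field K] : GL (Fin n) K →* (RatFun n K ≃ₐ[K] RatFun n K) where
  toFun g := IsFractionRing.fieldEquivOfAlgEquiv K (RatFun n K) (RatFun n K) (adPoly n K g)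
  map_one' := by
    rw [map_one]
    exact IsFractionRing.fieldEquivOfAlgEquiv_refl K (PolyFun n K) K (RatFun n K)
  map_mul' g h := by
    rw [map_mul]
    exact IsFractionRing.fieldEquivOfAlgEquiv_trans K (RatFun n K) (RatFun n K) (RatFun n K)
      (adPoly n K h) (adPoly n K g)

theorem adRat_algebraMap (n : ℕ) (K : Type*) [Field K] (g : GL (Fin n) K) (f : PolyFun n K) :
    adRat n K g (algebraMap (PolyFun n K) (RatFun n K) f) =
      algebraMap (PolyFun n K) (RatFun n K) (adPolyHom n K g f) :=
  IsFractionRing.fieldEquivOfAlgEquiv_algebraMap K (RatFun n K) (RatFun n K) (adPoly n K g) f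

/-- The Borel subgroup `B` of upper triangular matrices in `GL(n, K)`. -/
def borel (n : ℕ) (K : Type*) [Field K] : Subgroup (GL (Fin n) K) where
  carrier := {g | ∀ r c : Fin n, c < r → g.val r c = 0}
  one_mem' := fun r c hrc => by simp [hrc.ne']
  mul_mem' := fun {g h} hg hh =>
    Matrix.BlockTriangular.mul (b := id) (M := g.val) (N := h.val)
      (fun r c hrc => hg r c hrc) (fun r c hrc => hh r c hrc)
  inv_mem' := fun {g} hg => by
    intro r c hrc
    have : Invertible g.val := g.invertible
    have h := Matrix.blockTriangular_inv_of_blockTriangular (b := id) (M := g.val)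
      (fun r c hrc => hg r c hrc)
    rw [Matrix.coe_units_inv]
    exact h hrc

/-- The field of `B`-invariant rational functions on `Mat(n, K)`. -/
def invariantField (n : ℕ) (K : Type*) [Field K] : IntermediateField K (RatFun n K) :=
  IntermediateField.fixedField ((borel n K).map (adRat n K))

/-- The minor `J_{i,j}` of an `n × n` matrix `M` over a commutative ring (`j ≤ i ≤ n`): the
determinant of the `i × i` matrix on the first `i` columns whose first `i - j` rows are the last
`i - j` rows of `M` and whose last `j` rows are the last `j` rows of the adjugate of `M`. -/
def minorJ {R : Type*} [CommRing R] {n : ℕ} (M : Matrix (Fin n) (Fin n) R) (i j : ℕ)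
    (hi : i ≤ n) : R :=
  Matrix.det (Matrix.of fun r c : Fin i =>
    if h : (r : ℕ) < i - j then M ⟨n - (i - j) + r, by omega⟩ ⟨c, by omega⟩
    else M.adjugate ⟨n - i + r, by omega⟩ ⟨c, by omega⟩)

/-- `J_{i,j}` of the generic matrix, as a rational function. -/
def J (n : ℕ) (K : Type*) [Field K] (i j : ℕ) (hi : i ≤ n) : RatFun n K :=
  algebraMap (PolyFun n K) (RatFun n K) (minorJ (genericMatrix n K) i j hi)

/-- `y_1 = J_{1,0}` and `y_i = J_{i,i-1} / J_{i-1,0}` for `2 ≤ i ≤ n`. -/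
def y (n : ℕ) (K : Type*) [Field K] (i : ℕ) (hi : i ≤ n) : RatFun n K :=
  if i = 1 then J n K i 0 hi else J n K i (i - 1) hi / J n K (i - 1) 0 (by omega)

/-- `Y_{i,j} = J_{i,j} y_{n-i+j+1} / (J_{i-1,j} y_i)` for `2 ≤ i ≤ n` and `0 ≤ j ≤ i - 2`. -/
def Y (n : ℕ) (K : Type*) [Field K] (i j : ℕ) (hi : i ≤ n) (hj : j + 2 ≤ i) : RatFun n K :=
  J n K i j hi * y n K (n - i + j + 1) (by omega) / (J n K (i - 1) j (by omega) * y n K i hi)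

/-- The pairs `(i, j)` with `2 ≤ i ≤ n` and `0 ≤ j ≤ i - 2`. -/
abbrev YIndex (n : ℕ) : Type := {p : ℕ × ℕ // p.1 ≤ n ∧ p.2 + 2 ≤ p.1}

/-- The family consisting of `y_n` and of the `Y_{i,j}` with `2 ≤ i ≤ n` and `0 ≤ j ≤ i - 2`. -/
def generators (n : ℕ) (K : Type*) [Field K] : Option (YIndex n) → RatFun n K
  | none => y n K n le_rfl
  | some p => Y n K p.1.1 p.1.2 p.2.1 p.2.2

end

end BorelInvariants

namespace BorelInvariants

open Matrix

/-! Let `L = K(V)`, let `F` be the field generated by `y_n` and the `Y_{i,j}`, and let `M` be the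
generic matrix over `L`. Everything rests on a normal form: some upper triangular `g` over `L` makes
all entries of `S = g⁻¹ M g` lie in `F` (`exists_conj_mem`).

The minors `J_{i,j}` are semi-invariant under upper triangular conjugation
(`minorJ_conj_eq_weight`). So `y_i` has weight `t_{i-1} / t_{n-1}`, where `t` is the diagonal of `g`
counted from `0`, and the weights in `Y_{i,j}` cancel. A torus element makes `y_i = 1` for `i < n`,
and a unitriangular one then clears everything strictly below the antidiagonal. The `J_{i,j}` of the
result are obtained recursively from `y_n` and the `Y_{i,j}`, and they determine its entries
(`UpperLeft.forall_mem_of_minorJ_mem`): on such a matrix `J_{i,j}` splits into a minor of `S` and a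
minor of its adjugate.

An invariant `f` satisfies `f(M) = f(b⁻¹ M b)` for `b` in `B(K)`. As `K` is infinite, `B(K)` is
Zariski dense in `B(L)`, so `f(M) = f(S)` lies in `F` once the denominator is kept nonzero
(`invariantField_le_of_conj_mem`).

Independence is a count: `M = g S g⁻¹`, so the generators together with the free entries of `g`
generate `K(V)`. These are `n²` elements in a field of transcendence degree `n²`. -/

/-- The block of `j` consecutive indices of `Fin n` that starts at `c`. -/
def seg {n : ℕ} (c j : ℕ) (h : c + j ≤ n) : Fin j → Fin n := fun r => ⟨c + r, by omega⟩

@[simp] theorem seg_val {n c j : ℕ} (h : c + j ≤ n) (r : Fin j) : (seg c j h r : ℕ) = c + r := rfl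

theorem seg_injective {n c j : ℕ} (h : c + j ≤ n) : Function.Injective (seg c j h) := by
  intro r s hrs
  have := congrArg Fin.val hrs
  simp only [seg_val] at this
  exact Fin.ext (by omega)

theorem mem_range_seg {n c j : ℕ} (h : c + j ≤ n) (k : Fin n) :
    k ∈ Set.range (seg c j h) ↔ c ≤ k ∧ (k : ℕ) < c + j := by
  constructor
  · rintro ⟨r, rfl⟩
    simp
  · rintro ⟨h1, h2⟩
    exact ⟨⟨k - c, by omega⟩, Fin.ext (by simp; omega)⟩

theorem sum_eq_sum_seg {A : Type*} [AddCommMonoid A] {n c j : ℕ} (h : c + j ≤ n) (F : Fin n → A)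
    (hF : ∀ k : Fin n, ¬ (c ≤ (k : ℕ) ∧ (k : ℕ) < c + j) → F k = 0) :
    ∑ k, F k = ∑ r, F (seg c j h r) :=
  (Fintype.sum_of_injective _ (seg_injective h) _ _
    (fun k hk => hF k (by rwa [mem_range_seg] at hk)) fun _ => rfl).symm

/-! ### Semi-invariance of the minors under upper triangular conjugation -/

section CommRing

variable {R : Type*} [CommRing R] {n : ℕ}

/-- The minor on the last `j` rows and the `j` consecutive columns that start at `c`. -/
def bottomMinor (M : Matrix (Fin n) (Fin n) R) (j c : ℕ) (h : c + j ≤ n) : R :=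
  (M.submatrix (seg (n - j) j (by omega)) (seg c j h)).det

theorem minorJ_eq_det_fromRows (M : Matrix (Fin n) (Fin n) R) (a j : ℕ) (h : a + j ≤ n) :
    minorJ M (a + j) j h =
      ((fromRows (M.submatrix (seg (n - a) a (by omega)) (seg 0 (a + j) (by omega)))
        (M.adjugate.submatrix (seg (n - j) j (by omega)) (seg 0 (a + j) (by omega)))).submatrix
          finSumFinEquiv.symm id).det := by
  rw [minorJ]
  congr 1
  ext r c
  refine Fin.addCases (fun r => ?_) (fun r => ?_) r
  · simp only [of_apply, submatrix_apply, finSumFinEquiv_symm_apply_castAdd, fromRows_apply_inl]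
    rw [dif_pos (by simp)]
    congr 1 <;> exact Fin.ext (by simp)
  · simp only [of_apply, submatrix_apply, finSumFinEquiv_symm_apply_natAdd, fromRows_apply_inr]
    rw [dif_neg (by simp)]
    congr 1 <;> exact Fin.ext (by simp; try omega)

theorem minorJ_zero (M : Matrix (Fin n) (Fin n) R) (i : ℕ) (h : i ≤ n) :
    minorJ M i 0 h = bottomMinor M i 0 (by omega) := by
  rw [minorJ, bottomMinor]
  congr 1
  ext r c
  simp only [of_apply, submatrix_apply]
  rw [dif_pos (by simp)]
  congr 1
  exact Fin.ext (by simp)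

theorem minorJ_map {S : Type*} [CommRing S] (f : R →+* S) (M : Matrix (Fin n) (Fin n) R)
    (i j : ℕ) (h : i ≤ n) : minorJ (M.map f) i j h = f (minorJ M i j h) := by
  rw [minorJ, minorJ, RingHom.map_det]
  congr 1
  ext r c
  have hadj : (M.map f).adjugate = M.adjugate.map f := (RingHom.map_adjugate f M).symm
  simp only [of_apply, RingHom.mapMatrix_apply, map_apply, hadj]
  split_ifs <;> rfl

/-- The last `a` rows of an upper triangular matrix are supported on the last `a` columns. -/
theorem submatrix_last_mul {h M : Matrix (Fin n) (Fin n) R} (hh : h.BlockTriangular id)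
    {a : ℕ} (ha : n - a + a ≤ n) {m : Type*} (f : m → Fin n) :
    (h * M).submatrix (seg (n - a) a ha) f =
      h.submatrix (seg (n - a) a ha) (seg (n - a) a ha) * M.submatrix (seg (n - a) a ha) f := by
  ext r c
  simp only [submatrix_apply, mul_apply]
  refine sum_eq_sum_seg ha _ fun k hk => ?_
  rw [hh (Fin.lt_def.2 _), zero_mul]
  simp only [id, seg_val]
  omega

theorem submatrix_first_mul {g M : Matrix (Fin n) (Fin n) R} (hg : g.BlockTriangular id)
    {a : ℕ} (ha : 0 + a ≤ n) {m : Type*} (f : m → Fin n) :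
    (M * g).submatrix f (seg 0 a ha) =
      M.submatrix f (seg 0 a ha) * g.submatrix (seg 0 a ha) (seg 0 a ha) := by
  ext r c
  simp only [submatrix_apply, mul_apply]
  refine sum_eq_sum_seg ha _ fun k hk => ?_
  rw [hg (Fin.lt_def.2 _), mul_zero]
  simp only [id, seg_val]
  omega

/-- The adjugates of `g` and `h` are `g.det • h` and `h.det • g`, and the two scalars multiply to
`1`; `M` need not be invertible. -/
theorem adjugate_conj {h g : Matrix (Fin n) (Fin n) R} (hgh : h * g = 1)
    (M : Matrix (Fin n) (Fin n) R) : (h * M * g).adjugate = h * M.adjugate * g := by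
  have hd : h.det * g.det = 1 := by rw [← det_mul, hgh, det_one]
  have hgh' : g * h = 1 := mul_eq_one_comm.1 hgh
  have e1 : g.adjugate = g.det • h := by
    calc g.adjugate = g.adjugate * (g * h) := by rw [hgh', mul_one]
      _ = g.det • h := by rw [← mul_assoc, adjugate_mul, smul_mul_assoc, one_mul]
  have e2 : h.adjugate = h.det • g := by
    calc h.adjugate = h.adjugate * (h * g) := by rw [hgh, mul_one]
      _ = h.det • g := by rw [← mul_assoc, adjugate_mul, smul_mul_assoc, one_mul]
  rw [adjugate_mul_distrib, adjugate_mul_distrib, e1, e2]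
  simp only [smul_mul_assoc, mul_smul_comm, smul_smul, mul_assoc]
  rw [hd, one_smul]

theorem blockTriangular_submatrix_seg {g : Matrix (Fin n) (Fin n) R} (hg : g.BlockTriangular id)
    {c a : ℕ} (ha : c + a ≤ n) : (g.submatrix (seg c a ha) (seg c a ha)).BlockTriangular id := by
  intro r s hrs
  refine hg (Fin.lt_def.2 ?_)
  have := Fin.lt_def.1 hrs
  simp only [id, seg_val] at this ⊢
  omega

theorem det_submatrix_seg {g : Matrix (Fin n) (Fin n) R} (hg : g.BlockTriangular id)
    {c a : ℕ} (ha : c + a ≤ n) :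
    (g.submatrix (seg c a ha) (seg c a ha)).det = ∏ r, g (seg c a ha r) (seg c a ha r) :=
  det_of_isUpperTriangular (blockTriangular_submatrix_seg hg ha)

/-- The adjugate is conjugated along with `M`, so `h` acts on the two row blocks separately, through
its lower right corners, while `g` acts on the first columns through its upper left corner. The
determinant of the stacked matrix is thus multiplied by three corner determinants. -/
theorem minorJ_conj {h g : Matrix (Fin n) (Fin n) R} (hh : h.BlockTriangular id)
    (hg : g.BlockTriangular id) (hgh : h * g = 1) (M : Matrix (Fin n) (Fin n) R) (a j : ℕ)
    (hi : a + j ≤ n) :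
    minorJ (h * M * g) (a + j) j hi =
      (h.submatrix (seg (n - a) a (by omega)) (seg (n - a) a (by omega))).det *
      (h.submatrix (seg (n - j) j (by omega)) (seg (n - j) j (by omega))).det *
      (g.submatrix (seg 0 (a + j) (by omega)) (seg 0 (a + j) (by omega))).det *
      minorJ M (a + j) j hi := by
  rw [minorJ_eq_det_fromRows, minorJ_eq_det_fromRows, adjugate_conj hgh]
  set h1 := h.submatrix (seg (n - a) a (by omega)) (seg (n - a) a (by omega))
  set h2 := h.submatrix (seg (n - j) j (by omega)) (seg (n - j) j (by omega))
  set g' := g.submatrix (seg 0 (a + j) (by omega)) (seg 0 (a + j) (by omega))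
  rw [submatrix_first_mul hg, submatrix_last_mul hh, submatrix_first_mul hg, submatrix_last_mul hh]
  rw [← fromRows_mul]
  have key (A : Matrix (Fin a) (Fin (a + j)) R) (B : Matrix (Fin j) (Fin (a + j)) R) :
      fromRows (h1 * A) (h2 * B) = fromBlocks h1 0 0 h2 * fromRows A B := by
    rw [fromBlocks_mul_fromRows]
    simp
  rw [key]
  have e (P : Matrix (Fin a ⊕ Fin j) (Fin a ⊕ Fin j) R) (Q : Matrix (Fin a ⊕ Fin j) (Fin (a + j)) R)
      (S : Matrix (Fin (a + j)) (Fin (a + j)) R) :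
      (P * Q * S).submatrix finSumFinEquiv.symm id =
        P.submatrix finSumFinEquiv.symm finSumFinEquiv.symm *
          Q.submatrix finSumFinEquiv.symm id * S := by
    rw [submatrix_mul_equiv]
    rfl
  rw [e, det_mul, det_mul, det_submatrix_equiv_self, det_fromBlocks_zero₂₁]
  ring

end CommRing

section Field

variable {L : Type*} [Field L] {n : ℕ}

/-- The product of the last `a` of the `n` values `t 0, …, t (n - 1)`. -/
def lastProd (n : ℕ) (t : ℕ → L) (a : ℕ) : L := ∏ r : Fin a, t (n - a + r)

theorem lastProd_succ (t : ℕ → L) {a : ℕ} (ha : a < n) :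
    lastProd n t (a + 1) = t (n - (a + 1)) * lastProd n t a := by
  rw [lastProd, lastProd, Fin.prod_univ_succ]
  congr 1
  refine Finset.prod_congr rfl fun r _ => congrArg t ?_
  simp only [Fin.val_succ]
  omega

theorem lastProd_ne_zero {t : ℕ → L} (ht : ∀ k, t k ≠ 0) (a : ℕ) : lastProd n t a ≠ 0 :=
  Finset.prod_ne_zero_iff.2 fun _ _ => ht _

theorem diag_mul_of_blockTriangular {R : Type*} [CommRing R] {h g : Matrix (Fin n) (Fin n) R}
    (hh : h.BlockTriangular id) (hg : g.BlockTriangular id) (k : Fin n) :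
    (h * g) k k = h k k * g k k := by
  rw [mul_apply]
  refine Finset.sum_eq_single k (fun l _ hl => ?_) (by simp)
  rcases lt_or_gt_of_ne hl with hl | hl
  · rw [hh hl, zero_mul]
  · rw [hg hl, mul_zero]

/-- The weight of `J_{i,j}` under the torus. -/
theorem minorJ_conj_eq_weight {h g : Matrix (Fin n) (Fin n) L} (hh : h.BlockTriangular id)
    (hg : g.BlockTriangular id) (hgh : h * g = 1) {t : ℕ → L}
    (htg : ∀ k : Fin n, g k k = t k) (M : Matrix (Fin n) (Fin n) L) {i j : ℕ} (hji : j ≤ i)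
    (hi : i ≤ n) :
    minorJ (h * M * g) i j hi =
      (∏ k ∈ Finset.range i, t k) / (lastProd n t (i - j) * lastProd n t j) * minorJ M i j hi := by
  obtain ⟨a, rfl⟩ := Nat.exists_eq_add_of_le' hji
  have hth (k : Fin n) : h k k = (t k)⁻¹ := by
    have := diag_mul_of_blockTriangular hh hg k
    rw [hgh, one_apply_eq, htg] at this
    exact eq_inv_of_mul_eq_one_left this.symm
  have hlast (b : ℕ) (hb : n - b + b ≤ n) :
      (h.submatrix (seg (n - b) b hb) (seg (n - b) b hb)).det = (lastProd n t b)⁻¹ := by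
    rw [det_submatrix_seg hh, lastProd, ← Finset.prod_inv_distrib]
    exact Finset.prod_congr rfl fun r _ => hth _
  rw [minorJ_conj hh hg hgh, hlast, hlast, det_submatrix_seg hg, Nat.add_sub_cancel,
    Finset.prod_range]
  simp only [htg, seg_val, zero_add]
  rw [div_eq_mul_inv, mul_inv]
  ring

end Field

/-! ### Matrices that vanish on one side of the antidiagonal -/

section CommRing

variable {R : Type*} [CommRing R] {n : ℕ}

/-- A matrix that vanishes strictly below the antidiagonal. -/
def UpperLeft (S : Matrix (Fin n) (Fin n) R) : Prop := ∀ r c : Fin n, n ≤ r + c → S r c = 0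

/-- Reversing the rows gives a lower triangular matrix. -/
theorem UpperLeft.det_eq {S : Matrix (Fin n) (Fin n) R} (hS : UpperLeft S) :
    S.det = Equiv.Perm.sign (Fin.revPerm (n := n)) * ∏ c, S (Fin.rev c) c := by
  have h1 := det_permute (Fin.revPerm (n := n)) S
  rw [det_of_isLowerTriangular] at h1
  · change ∏ c, S (Fin.rev c) c = _ at h1
    rw [h1, ← mul_assoc, ← Int.cast_mul, ← Units.val_mul, Int.units_mul_self]
    simp
  · intro r c hrc
    refine hS _ _ ?_
    have := Fin.lt_def.1 (OrderDual.toDual_lt_toDual.1 hrc)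
    simp only [Fin.revPerm_apply, Fin.val_rev, id]
    omega

theorem det_eq_of_lowerRight {S : Matrix (Fin n) (Fin n) R}
    (hS : ∀ r c : Fin n, (r : ℕ) + c + 1 < n → S r c = 0) :
    S.det = Equiv.Perm.sign (Fin.revPerm (n := n)) * ∏ c, S (Fin.rev c) c := by
  have h1 := det_permute (Fin.revPerm (n := n)) S
  rw [det_of_isUpperTriangular] at h1
  · change ∏ c, S (Fin.rev c) c = _ at h1
    rw [h1, ← mul_assoc, ← Int.cast_mul, ← Units.val_mul, Int.units_mul_self]
    simp
  · intro r c hrc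
    refine hS _ _ ?_
    have := Fin.lt_def.1 hrc
    simp only [id, Fin.revPerm_apply, Fin.val_rev] at this ⊢
    omega

theorem UpperLeft.bottomMinor_eq {S : Matrix (Fin n) (Fin n) R} (hS : UpperLeft S) {i : ℕ}
    (h : 0 + i ≤ n) :
    bottomMinor S i 0 h = Equiv.Perm.sign (Fin.revPerm (n := i)) *
      ∏ c : Fin i, S (Fin.rev (seg 0 i h c)) (seg 0 i h c) := by
  rw [bottomMinor, UpperLeft.det_eq]
  · congr 1
    refine Finset.prod_congr rfl fun c _ => ?_
    simp only [submatrix_apply]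
    congr 1
    ext
    simp only [seg_val, Fin.val_rev]
    omega
  · intro r c hrc
    refine hS _ _ ?_
    simp only [seg_val]
    omega

theorem bottomMinor_eq_of_lowerRight {S : Matrix (Fin n) (Fin n) R}
    (hS : ∀ r c : Fin n, (r : ℕ) + c + 1 < n → S r c = 0) {i : ℕ} (h : 0 + i ≤ n) :
    bottomMinor S i 0 h = Equiv.Perm.sign (Fin.revPerm (n := i)) *
      ∏ c : Fin i, S (Fin.rev (seg 0 i h c)) (seg 0 i h c) := by
  rw [bottomMinor, det_eq_of_lowerRight]
  · congr 1
    refine Finset.prod_congr rfl fun c _ => ?_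
    simp only [submatrix_apply]
    congr 1
    ext
    simp only [seg_val, Fin.val_rev]
    omega
  · intro r c hrc
    refine hS _ _ ?_
    simp only [seg_val]
    omega

/-- The last `a` rows of `S` vanish from column `a` on, so the stacked matrix is block lower
triangular. -/
theorem UpperLeft.minorJ_eq {S : Matrix (Fin n) (Fin n) R} (hS : UpperLeft S) (a j : ℕ)
    (h : a + j ≤ n) :
    minorJ S (a + j) j h =
      bottomMinor S a 0 (by omega) * bottomMinor S.adjugate j a h := by
  rw [minorJ_eq_det_fromRows, bottomMinor, bottomMinor]
  set A := S.submatrix (seg (n - a) a (by omega)) (seg 0 a (by omega))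
  set C := S.adjugate.submatrix (seg (n - j) j (by omega)) (seg 0 a (by omega))
  set D := S.adjugate.submatrix (seg (n - j) j (by omega)) (seg a j h)
  rw [← det_fromBlocks_zero₁₂ A C D, ← det_submatrix_equiv_self finSumFinEquiv.symm]
  congr 1
  ext r c
  refine Fin.addCases (fun r => ?_) (fun r => ?_) r <;>
    refine Fin.addCases (fun c => ?_) (fun c => ?_) c
  · simp only [submatrix_apply, finSumFinEquiv_symm_apply_castAdd, fromRows_apply_inl,
      fromBlocks_apply₁₁, A]
    congr 1
  · simp only [submatrix_apply, finSumFinEquiv_symm_apply_castAdd, fromRows_apply_inl,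
      fromBlocks_apply₁₂, finSumFinEquiv_symm_apply_natAdd, Matrix.zero_apply]
    refine hS _ _ ?_
    simp only [seg_val, id, Fin.val_natAdd]
    omega
  · simp only [submatrix_apply, finSumFinEquiv_symm_apply_castAdd, fromRows_apply_inr,
      fromBlocks_apply₂₁, finSumFinEquiv_symm_apply_natAdd, C]
    congr 1
  · simp only [submatrix_apply, fromRows_apply_inr,
      fromBlocks_apply₂₂, finSumFinEquiv_symm_apply_natAdd, D]
    congr 1
    ext
    simp

end CommRing

/-! ### The unipotent normal form and its recovery from minors -/

section Field

variable {L : Type*} [Field L] {n : ℕ}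

/-- A matrix with nonzero lower left minors is conjugate, by a unitriangular matrix, to one that
vanishes strictly below the antidiagonal. -/
theorem exists_unitriangular_conj_upperLeft (M : Matrix (Fin n) (Fin n) L)
    (hM : ∀ i (hi : 0 + i ≤ n), bottomMinor M i 0 hi ≠ 0) :
    ∃ u v : Matrix (Fin n) (Fin n) L, u.BlockTriangular id ∧ v.BlockTriangular id ∧
      v * u = 1 ∧ (∀ k, u k k = 1) ∧ UpperLeft (v * M * u) := by
  -- Column `c` of `u` above the diagonal: the combination of columns `0, …, c - 1` of `M` that
  -- cancels the last `c` entries of column `c`. The system is solvable because its determinant is a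
  -- lower left minor.
  have hsolve (c : Fin n) : ∃ x : Fin (c : ℕ) → L,
      M.submatrix (seg (n - c) c (by omega)) (seg 0 (c : ℕ) (by omega)) *ᵥ x =
        fun r => - M (seg (n - c) c (by omega) r) c := by
    refine ⟨(M.submatrix (seg (n - c) c (by omega)) (seg 0 (c : ℕ) (by omega)))⁻¹ *ᵥ
      (fun r => - M (seg (n - c) c (by omega) r) c), ?_⟩
    rw [mulVec_mulVec, mul_nonsing_inv _ (isUnit_iff_ne_zero.2 (hM c (by omega))), one_mulVec]
  choose x hx using hsolve
  let u : Matrix (Fin n) (Fin n) L :=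
    of fun r c => if h : r < c then x c ⟨r, h⟩ else if r = c then 1 else 0
  have hu : u.BlockTriangular id := by
    intro r c hrc
    have hrc' : c < r := hrc
    simp [u, hrc'.not_gt, hrc'.ne']
  have hu1 (k : Fin n) : u k k = 1 := by simp [u]
  have hdet : u.det = 1 := by
    rw [det_of_isUpperTriangular hu]
    exact Finset.prod_eq_one fun k _ => hu1 k
  have hunit : IsUnit u.det := by rw [hdet]; exact isUnit_one
  have : Invertible u := u.invertibleOfIsUnitDet hunit
  have hv : (u⁻¹).BlockTriangular id := blockTriangular_inv_of_blockTriangular hu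
  refine ⟨u, u⁻¹, hu, hv, nonsing_inv_mul u hunit, hu1, ?_⟩
  have hMu : UpperLeft (M * u) := by
    intro r c hrc
    have h1 := congrFun (hx c) ⟨r - (n - c), by omega⟩
    have hr : seg (n - c) (c : ℕ) (by omega) ⟨r - (n - c), by omega⟩ = r := by
      ext
      simp only [seg_val]
      omega
    rw [mulVec, dotProduct, hr] at h1
    have h2 : ∑ k, (M r k * u k c - if k = c then M r c else 0) =
        ∑ k : Fin (c : ℕ), M r (seg 0 (c : ℕ) (by omega) k) * x c k := by
      rw [sum_eq_sum_seg (c := 0) (j := (c : ℕ)) (by omega)]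
      · refine Finset.sum_congr rfl fun k _ => ?_
        have hk : seg 0 (c : ℕ) (by omega) k < c := Fin.lt_def.2 (by simp)
        rw [if_neg hk.ne, sub_zero]
        simp only [u, of_apply, dif_pos hk]
        congr 2
        ext
        simp
      · intro k hk
        rcases eq_or_ne k c with rfl | hkc
        · simp [hu1]
        · rw [if_neg hkc, hu, mul_zero, sub_zero]
          refine lt_of_le_of_ne (Fin.le_def.2 ?_) (Ne.symm hkc)
          simp only [id]
          omega
    rw [Finset.sum_sub_distrib, Finset.sum_ite_eq' Finset.univ c] at h2
    simp only [Finset.mem_univ, if_true, submatrix_apply, hr] at h1 h2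
    rw [h1] at h2
    rw [mul_apply]
    linear_combination h2
  -- Row `r` of `v * N` only involves rows of `N` from `r` downwards, so left multiplication by `v`
  -- keeps the shape.
  intro r c hrc
  rw [mul_assoc, mul_apply]
  refine Finset.sum_eq_zero fun k _ => ?_
  rcases lt_or_ge k r with hk | hk
  · rw [hv hk, zero_mul]
  · rw [hMu k c (by have := Fin.le_def.1 hk; omega), mul_zero]

theorem det_mem_of_forall_mem (F : Subfield L) {m : Type*} [Fintype m] [DecidableEq m]
    {M : Matrix m m L} (hM : ∀ r c, M r c ∈ F) : M.det ∈ F := by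
  rw [det_apply]
  refine F.sum_mem fun σ _ => ?_
  rw [Units.smul_def]
  exact zsmul_mem (F.prod_mem fun i _ => hM _ _) _

theorem adjugate_mem_of_forall_mem (F : Subfield L) {m : Type*} [Fintype m] [DecidableEq m]
    {M : Matrix m m L} (hM : ∀ r c, M r c ∈ F) (r c : m) : M.adjugate r c ∈ F := by
  rw [adjugate_apply]
  refine det_mem_of_forall_mem F fun a b => ?_
  rw [updateRow_apply]
  split_ifs
  · rw [Pi.single_apply]
    split_ifs
    exacts [F.one_mem, F.zero_mem]
  · exact hM _ _

theorem inv_mem_of_forall_mem (F : Subfield L) {m : Type*} [Fintype m] [DecidableEq m]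
    {M : Matrix m m L} (hM : ∀ r c, M r c ∈ F) (r c : m) : M⁻¹ r c ∈ F := by
  rw [inv_def, Ring.inverse_eq_inv', Matrix.smul_apply, smul_eq_mul]
  exact F.mul_mem (F.inv_mem (det_mem_of_forall_mem F hM)) (adjugate_mem_of_forall_mem F hM r c)

theorem mul_mem_of_forall_mem (F : Subfield L) {m : Type*} [Fintype m] {M N : Matrix m m L}
    (hM : ∀ r c, M r c ∈ F) (hN : ∀ r c, N r c ∈ F) (r c : m) : (M * N) r c ∈ F := by
  rw [mul_apply]
  exact F.sum_mem fun k _ => F.mul_mem (hM r k) (hN k c)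

theorem sign_mul_mem_iff (F : Subfield L) (e : ℤˣ) (x : L) : ((e : ℤ) : L) * x ∈ F ↔ x ∈ F := by
  rcases Int.units_eq_one_or e with rfl | rfl <;> simp

theorem sign_mul_ne_zero_iff (e : ℤˣ) (x : L) : ((e : ℤ) : L) * x ≠ 0 ↔ x ≠ 0 := by
  rcases Int.units_eq_one_or e with rfl | rfl <;> simp

/-- Row `rev k` of `S` is supported on the columns up to `k`. In the corresponding row of `S *
S.adjugate = S.det • 1` the terms with column below `k` vanish by induction, which leaves one
product. -/
theorem UpperLeft.mul_adjugate {S : Matrix (Fin n) (Fin n) L} (hS : UpperLeft S)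
    (hd : ∀ c, S (Fin.rev c) c ≠ 0) (k c : Fin n) (hkc : (k : ℕ) + c + 1 ≤ n) :
    S (Fin.rev k) k * S.adjugate k c = if Fin.rev k = c then S.det else 0 := by
  obtain ⟨m, hm⟩ : ∃ m, m = (k : ℕ) := ⟨_, rfl⟩
  induction m using Nat.strong_induction_on generalizing k with
  | _ m ih =>
    subst hm
    have h1 := congrFun (congrFun (Matrix.mul_adjugate S) (Fin.rev k)) c
    rw [mul_apply, Finset.sum_eq_single k, Matrix.smul_apply, one_apply, smul_eq_mul, mul_ite, mul_one,
      mul_zero] at h1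
    · exact h1
    · intro l _ hl
      rcases lt_or_gt_of_ne hl with hl | hl
      · have hlk := Fin.lt_def.1 hl
        have h2 := ih l hlk l (by omega) rfl
        rw [if_neg, mul_eq_zero] at h2
        · rw [h2.resolve_left (hd l), mul_zero]
        · intro h
          rw [← h, Fin.val_rev] at hkc
          omega
      · rw [hS, zero_mul]
        have := Fin.lt_def.1 hl
        rw [Fin.val_rev]
        omega
    · simp

theorem UpperLeft.adjugate_eq_zero {S : Matrix (Fin n) (Fin n) L} (hS : UpperLeft S)
    (hd : ∀ c, S (Fin.rev c) c ≠ 0) (r c : Fin n) (hrc : (r : ℕ) + c + 1 < n) :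
    S.adjugate r c = 0 := by
  have h := hS.mul_adjugate hd r c hrc.le
  rw [if_neg, mul_eq_zero] at h
  · exact h.resolve_left (hd r)
  · intro h
    rw [← h, Fin.val_rev] at hrc
    omega

/-- A matrix is determined by its minors on the last rows and consecutive columns, if it vanishes
strictly above the antidiagonal. -/
theorem forall_mem_of_bottomMinor_mem (F : Subfield L) {Z : Matrix (Fin n) (Fin n) L}
    (hZ : ∀ r c : Fin n, (r : ℕ) + c + 1 < n → Z r c = 0)
    (h0 : ∀ j c h, bottomMinor Z j c h ≠ 0) (hF : ∀ j c h, bottomMinor Z j c h ∈ F)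
    (r c : Fin n) : Z r c ∈ F := by
  -- Rows are treated from the bottom up, and each row from left to right. The minor of size `j + 1`
  -- with upper right corner `(r, c)` is expanded along its first row: all other entries are known,
  -- and the cofactor of `Z r c` is, up to sign, a nonzero minor of size `j`.
  suffices H : ∀ j : ℕ, j ≤ n → ∀ r c : Fin n, n ≤ r + j → Z r c ∈ F from
    H n le_rfl r c (by omega)
  intro j
  induction j with
  | zero => intro _ r c h; omega
  | succ j ih =>
    intro hj r c hr
    rcases Nat.lt_or_ge (r + j) n with hrj | hrj
    swap
    · exact ih (by omega) r c hrj
    obtain ⟨m, hm⟩ : ∃ m, m = (c : ℕ) := ⟨_, rfl⟩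
    induction m using Nat.strong_induction_on generalizing c with
    | _ m ihc =>
      subst hm
      rcases Nat.lt_or_ge (c : ℕ) j with hcj | hcj
      · rw [hZ r c (by omega)]
        exact F.zero_mem
      have hdet := hF (j + 1) (c - j) (by omega)
      rw [bottomMinor, det_succ_row_zero, Fin.sum_univ_castSucc] at hdet
      have hrow : seg (n - (j + 1)) (j + 1) (by omega) 0 = r := by
        ext
        simp only [seg_val, Fin.val_zero]
        omega
      have hcol : seg (c - j) (j + 1) (by omega) (Fin.last j) = c := by
        ext
        simp only [seg_val, Fin.val_last]
        omega
      have hrows (q : Fin j) : n ≤ (seg (n - (j + 1)) (j + 1) (by omega) q.succ : Fin n) + j := by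
        simp only [seg_val, Fin.val_succ]
        omega
      rw [add_mem_cancel_left] at hdet
      · have hminor : ((Z.submatrix (seg (n - (j + 1)) (j + 1) (by omega))
            (seg (c - j) (j + 1) (by omega))).submatrix Fin.succ (Fin.last j).succAbove).det =
              bottomMinor Z j (c - j) (by omega) := by
          rw [bottomMinor]
          congr 1
          ext a b
          simp only [submatrix_apply, Fin.succAbove_last]
          congr 1
          ext
          simp only [seg_val, Fin.val_succ]
          omega
        rw [hminor, submatrix_apply, hrow, hcol] at hdet
        have h1 := F.div_mem hdet (hF j (c - j) (by omega))
        rw [mul_div_cancel_right₀ _ (h0 j (c - j) (by omega))] at h1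
        have h2 := F.mul_mem (F.pow_mem (F.neg_mem F.one_mem) (Fin.last j : ℕ)) h1
        rwa [← mul_assoc, ← mul_pow, neg_one_mul, neg_neg, one_pow, one_mul] at h2
      · refine F.sum_mem fun q _ => F.mul_mem (F.mul_mem
          (F.pow_mem (F.neg_mem F.one_mem) _) ?_) (det_mem_of_forall_mem F fun a b => ?_)
        · rw [submatrix_apply, hrow]
          refine ihc _ ?_ _ rfl
          simp only [seg_val, Fin.val_castSucc]
          omega
        · exact ih (by omega) _ _ (hrows a)

/-- The entries of a matrix that vanishes strictly below the antidiagonal are rational functions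
of its minors `J_{i,j}`. -/
theorem UpperLeft.forall_mem_of_minorJ_mem (F : Subfield L) {S : Matrix (Fin n) (Fin n) L}
    (hS : UpperLeft S) (h0 : ∀ i j hi, j < i → minorJ S i j hi ≠ 0)
    (hF : ∀ i j hi, j < i → minorJ S i j hi ∈ F) (r c : Fin n) : S r c ∈ F := by
  -- `P i` is the product of the first `i` antidiagonal entries, which is `J_{i,0}` up to sign;
  -- successive quotients give the entries. The default `1` is never reached.
  set P : ℕ → L := fun i => if h : 0 + i ≤ n then
    ∏ c : Fin i, S (Fin.rev (seg 0 i h c)) (seg 0 i h c) else 1 with hP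
  have hbm0 (i : ℕ) (h : 0 + i ≤ n) : bottomMinor S i 0 h ≠ 0 := by
    rcases Nat.eq_zero_or_pos i with rfl | hi
    · simp [bottomMinor]
    · rw [← minorJ_zero S i (by omega)]
      exact h0 _ _ _ hi
  have hbmF (i : ℕ) (h : 0 + i ≤ n) : bottomMinor S i 0 h ∈ F := by
    rcases Nat.eq_zero_or_pos i with rfl | hi
    · simp [bottomMinor]
    · rw [← minorJ_zero S i (by omega)]
      exact hF _ _ _ hi
  have hP0 (i : ℕ) (h : 0 + i ≤ n) : P i ≠ 0 := by
    have := hbm0 i h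
    rw [hS.bottomMinor_eq, sign_mul_ne_zero_iff] at this
    simpa only [hP, dif_pos h] using this
  have hPF (i : ℕ) (h : 0 + i ≤ n) : P i ∈ F := by
    have := hbmF i h
    rw [hS.bottomMinor_eq, sign_mul_mem_iff] at this
    simpa only [hP, dif_pos h] using this
  have hPsucc (c : Fin n) : P (c + 1) = P c * S (Fin.rev c) c := by
    simp only [hP]
    rw [dif_pos (by omega), dif_pos (by omega), Fin.prod_univ_castSucc]
    have hc : seg 0 (c + 1) (by omega) (Fin.last c) = c := by
      ext
      simp
    rw [hc]
    rfl
  have hd0 (c : Fin n) : S (Fin.rev c) c ≠ 0 := by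
    have := hP0 (c + 1) (by omega)
    rw [hPsucc] at this
    exact right_ne_zero_of_mul this
  have hdF (c : Fin n) : S (Fin.rev c) c ∈ F := by
    have := F.div_mem (hPF (c + 1) (by omega)) (hPF c (by omega))
    rwa [hPsucc, mul_div_cancel_left₀ _ (hP0 c (by omega))] at this
  have hdet0 : S.det ≠ 0 := by
    rw [hS.det_eq, sign_mul_ne_zero_iff]
    exact Finset.prod_ne_zero_iff.2 fun c _ => hd0 c
  have hdetF : S.det ∈ F := by
    rw [hS.det_eq, sign_mul_mem_iff]
    exact F.prod_mem fun c _ => hdF c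
  have hZ := hS.adjugate_eq_zero hd0
  have hanti (c : Fin n) : S (Fin.rev (Fin.rev c)) (Fin.rev c) * S.adjugate (Fin.rev c) c =
      S.det := by
    rw [hS.mul_adjugate hd0 (Fin.rev c) c (by rw [Fin.val_rev]; omega), if_pos (Fin.rev_rev c)]
  have hanti0 (c : Fin n) : S.adjugate (Fin.rev c) c ≠ 0 := by
    have := hanti c ▸ hdet0
    exact right_ne_zero_of_mul this
  have hantiF (c : Fin n) : S.adjugate (Fin.rev c) c ∈ F := by
    have := F.div_mem hdetF (hdF (Fin.rev c))
    rwa [← hanti c, mul_div_cancel_left₀ _ (hd0 _)] at this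
  have hadj : ∀ r c, S.adjugate r c ∈ F := by
    refine forall_mem_of_bottomMinor_mem F hZ (fun j a h => ?_) (fun j a h => ?_)
    -- For `a = 0` the minor would come from `J_{j,j}`, which the hypotheses exclude; it is instead
    -- a signed product of antidiagonal entries of the adjugate.
    · rcases Nat.eq_zero_or_pos a with rfl | ha
      · rw [bottomMinor_eq_of_lowerRight hZ, sign_mul_ne_zero_iff]
        exact Finset.prod_ne_zero_iff.2 fun c _ => hanti0 _
      · have := h0 (a + j) j h (by omega)
        rw [hS.minorJ_eq] at this
        exact right_ne_zero_of_mul this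
    · rcases Nat.eq_zero_or_pos a with rfl | ha
      · rw [bottomMinor_eq_of_lowerRight hZ, sign_mul_mem_iff]
        exact F.prod_mem fun c _ => hantiF _
      · have := F.div_mem (hF (a + j) j h (by omega)) (hbmF a (by omega))
        rwa [hS.minorJ_eq, mul_div_cancel_left₀ _ (hbm0 a (by omega))] at this
  have hinv : S⁻¹⁻¹ = S := nonsing_inv_nonsing_inv S (isUnit_iff_ne_zero.2 hdet0)
  have h1 (r c : Fin n) : S⁻¹ r c ∈ F := by
    rw [inv_def, Ring.inverse_eq_inv', Matrix.smul_apply, smul_eq_mul]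
    exact F.mul_mem (F.inv_mem hdetF) (hadj r c)
  rw [← hinv]
  exact inv_mem_of_forall_mem F h1 r c

end Field

/-! ### Nonvanishing of the minors, from a binomial matrix -/

section Pascal

variable (n : ℕ) (K : Type*) [Field K]

/-- The matrix with entries `binom(c, r)`, which is upper unitriangular. -/
def pascal : Matrix (Fin n) (Fin n) K := of fun r c => ((c : ℕ).choose r : K)

theorem pascal_blockTriangular : (pascal n K).BlockTriangular id := by
  intro r c hrc
  have h : (c : ℕ) < r := hrc
  rw [pascal, of_apply, Nat.choose_eq_zero_of_lt h, Nat.cast_zero]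

theorem det_pascal : (pascal n K).det = 1 := by
  rw [det_of_isUpperTriangular (pascal_blockTriangular n K)]
  exact Finset.prod_eq_one fun k _ => by simp [pascal]

/-- Vandermonde's convolution factors the matrix into a lower unitriangular Toeplitz matrix and the
Pascal matrix. -/
theorem det_choose_add (j c : ℕ) :
    (of fun a b : Fin j => ((c + b : ℕ).choose a : K)).det = 1 := by
  have h : (of fun a b : Fin j => ((c + b : ℕ).choose a : K)) =
      (of fun a l : Fin j => if l ≤ a then (c.choose (a - l) : K) else 0) * pascal j K := by
    ext a b
    simp only [of_apply, mul_apply, pascal, ite_mul, zero_mul]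
    rw [Nat.add_choose_eq, Finset.Nat.sum_antidiagonal_eq_sum_range_succ_mk,
      ← Finset.sum_range_reflect, Nat.cast_sum]
    have h2 : ∀ l : Fin j, (if l ≤ a then (c.choose (a - l) : K) * ((b : ℕ).choose l : K) else 0) =
        (fun l : ℕ => if l ≤ a then (c.choose (a - l) : K) * ((b : ℕ).choose l : K) else 0) l :=
      fun l => by simp only [Fin.le_def]
    rw [Finset.sum_congr rfl fun l _ => h2 l, 
      ← Finset.sum_range (fun l : ℕ => if l ≤ (a : ℕ) then (c.choose (a - l) : K) *
        ((b : ℕ).choose l : K) else 0), ← Finset.sum_filter]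
    refine Finset.sum_congr ?_ fun l hl => ?_
    · ext l
      simp only [Finset.mem_range, Finset.mem_filter]
      omega
    · rw [Finset.mem_filter] at hl
      push_cast
      congr 4
      omega
  rw [h, det_mul, det_pascal, mul_one, det_of_isLowerTriangular]
  · exact Finset.prod_eq_one fun k _ => by simp
  · intro r l hrl
    have : r < l := hrl
    simp [this.not_ge]

/-- The witness is the inverse Pascal matrix with reversed columns. It vanishes strictly below the
antidiagonal, and its inverse is the Pascal matrix with reversed rows, whose bottom minors on
consecutive columns are `±1`. -/
theorem exists_minorJ_ne_zero :
    ∃ S : Matrix (Fin n) (Fin n) K, ∀ i j hi, j ≤ i → minorJ S i j hi ≠ 0 := by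
  set W := pascal n K
  have hW : IsUnit W.det := by rw [det_pascal]; exact isUnit_one
  have : Invertible W := W.invertibleOfIsUnitDet hW
  have hWinv : (W⁻¹).BlockTriangular id :=
    blockTriangular_inv_of_blockTriangular (pascal_blockTriangular n K)
  set S := W⁻¹.submatrix id (Fin.revPerm (n := n)) with hSdef
  set Z := W.submatrix (Fin.revPerm (n := n)) id with hZdef
  have hSZ : S * Z = 1 := by
    rw [hSdef, hZdef, submatrix_mul_equiv, nonsing_inv_mul _ hW, submatrix_id_id]
  have hdet : S.det ≠ 0 := by
    have := congrArg det hSZ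
    rw [det_mul, det_one] at this
    exact left_ne_zero_of_mul (this ▸ one_ne_zero)
  have hadj : S.adjugate = S.det • Z := by
    calc S.adjugate = S.adjugate * (S * Z) := by rw [hSZ, mul_one]
      _ = S.det • Z := by rw [← mul_assoc, adjugate_mul, smul_mul_assoc, one_mul]
  have hS : UpperLeft S := by
    intro r c hrc
    refine hWinv (Fin.lt_def.2 ?_)
    simp only [id, Fin.revPerm_apply, Fin.val_rev]
    omega
  have hd : ∀ c, S (Fin.rev c) c ≠ 0 := by
    rw [hS.det_eq, sign_mul_ne_zero_iff] at hdet
    exact fun c => Finset.prod_ne_zero_iff.1 hdet c (Finset.mem_univ c)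
  refine ⟨S, fun i j hi hji => ?_⟩
  obtain ⟨a, rfl⟩ := Nat.exists_eq_add_of_le' hji
  rw [hS.minorJ_eq]
  refine mul_ne_zero ?_ ?_
  · rw [hS.bottomMinor_eq, sign_mul_ne_zero_iff]
    exact Finset.prod_ne_zero_iff.2 fun c _ => hd _
  · rw [bottomMinor, hadj, submatrix_smul, Pi.smul_apply, Pi.smul_apply, det_smul]
    refine mul_ne_zero (pow_ne_zero _ hdet) ?_
    have h1 : (Z.submatrix (seg (n - j) j (by omega)) (seg a j hi)).submatrix
        (Fin.revPerm (n := j)) id = of fun r b : Fin j => ((a + b : ℕ).choose r : K) := by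
      ext r b
      simp only [hZdef, W, pascal, submatrix_apply, of_apply, id, Fin.revPerm_apply, seg_val,
        Fin.val_rev]
      congr 2
      omega
    have h2 := det_permute (Fin.revPerm (n := j))
      (Z.submatrix (seg (n - j) j (by omega)) (seg a j hi))
    rw [h1, det_choose_add] at h2
    exact right_ne_zero_of_mul (h2 ▸ one_ne_zero)

theorem J_ne_zero (i j : ℕ) (hi : i ≤ n) (hji : j ≤ i) : J n K i j hi ≠ 0 := by
  obtain ⟨S, hS⟩ := exists_minorJ_ne_zero n K
  intro h
  rw [J, map_eq_zero_iff _ (IsFractionRing.injective (PolyFun n K) (RatFun n K))] at h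
  have h1 := minorJ_map (MvPolynomial.eval fun p : Fin n × Fin n => S p.1 p.2)
    (genericMatrix n K) i j hi
  rw [h, map_zero] at h1
  refine hS i j hi hji ?_
  rw [← h1]
  congr 1
  ext r c
  simp

end Pascal

/-! ### Density of the Borel subgroup over an infinite subfield -/

/-- The upper triangular matrix with entries `x (r, c)` for `r ≤ c`. -/
def upperPart {R : Type*} [Zero R] {n : ℕ} (x : Fin n × Fin n → R) : Matrix (Fin n) (Fin n) R :=
  of fun r c => if r ≤ c then x (r, c) else 0

theorem upperPart_blockTriangular {R : Type*} [Zero R] {n : ℕ} (x : Fin n × Fin n → R) :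
    (upperPart x).BlockTriangular id := by
  intro r c hrc
  have h : c < r := hrc
  simp [upperPart, h.not_ge]

theorem det_upperPart {R : Type*} [CommRing R] {n : ℕ} (x : Fin n × Fin n → R) :
    (upperPart x).det = ∏ k, x (k, k) := by
  rw [det_of_isUpperTriangular (upperPart_blockTriangular x)]
  simp [upperPart]

theorem upperPart_eq {R : Type*} [Zero R] {n : ℕ} {g : Matrix (Fin n) (Fin n) R}
    (hg : g.BlockTriangular id) : upperPart (fun a => g a.1 a.2) = g := by
  ext r c
  simp only [upperPart, of_apply]
  split_ifs with h
  · rfl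
  · exact (hg (not_le.1 h)).symm

theorem upperPart_map {R S : Type*} [CommRing R] [CommRing S] (f : R →+* S) {n : ℕ}
    (x : Fin n × Fin n → R) : (upperPart x).map f = upperPart (f ∘ x) := by
  ext r c
  simp only [upperPart, map_apply, of_apply, Function.comp]
  split_ifs <;> simp

/-- The inverse is the adjugate divided by the determinant, so a power of the determinant turns the
value at the conjugate into a polynomial in the entries of the conjugating matrix. -/
theorem exists_eval_conj_upperPart {L : Type*} [Field L] {n : ℕ}
    (M : Matrix (Fin n) (Fin n) L) (q : MvPolynomial (Fin n × Fin n) L) :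
    ∃ (N : ℕ) (P : MvPolynomial (Fin n × Fin n) L), ∀ x : Fin n × Fin n → L,
      (upperPart x).det ≠ 0 → MvPolynomial.eval x P = (upperPart x).det ^ N *
        MvPolynomial.eval (fun a => ((upperPart x)⁻¹ * M * upperPart x) a.1 a.2) q := by
  set G : Matrix (Fin n) (Fin n) (MvPolynomial (Fin n × Fin n) L) := upperPart MvPolynomial.X
  have hG (x : Fin n × Fin n → L) : G.map (MvPolynomial.eval x) = upperPart x := by
    rw [upperPart_map]
    congr 1
    ext a
    simp
  have hdet (x : Fin n × Fin n → L) : MvPolynomial.eval x G.det = (upperPart x).det := by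
    rw [RingHom.map_det, RingHom.mapMatrix_apply, hG]
  induction q using MvPolynomial.induction_on with
  | C a => exact ⟨0, MvPolynomial.C a, fun x _ => by simp⟩
  | add p q hp hq =>
    obtain ⟨N₁, P₁, h₁⟩ := hp
    obtain ⟨N₂, P₂, h₂⟩ := hq
    refine ⟨N₁ + N₂, P₁ * G.det ^ N₂ + P₂ * G.det ^ N₁, fun x hx => ?_⟩
    simp only [map_add, map_mul, map_pow, h₁ x hx, h₂ x hx, hdet]
    ring
  | mul_X p a hp =>
    obtain ⟨N, P, h⟩ := hp
    refine ⟨N + 1, P * (G.adjugate * M.map (MvPolynomial.C (σ := Fin n × Fin n)) * G) a.1 a.2, fun x hx => ?_⟩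
    have h1 : (G.adjugate * M.map (MvPolynomial.C (σ := Fin n × Fin n)) * G).map (MvPolynomial.eval x) =
        (upperPart x).det • ((upperPart x)⁻¹ * M * upperPart x) := by
      have hadj : G.adjugate.map (MvPolynomial.eval x) = (upperPart x).adjugate := by
        rw [← hG x]
        exact RingHom.map_adjugate (MvPolynomial.eval x) G
      have hM : (M.map (MvPolynomial.C (σ := Fin n × Fin n))).map (MvPolynomial.eval x) = M := by
        ext r c
        simp
      rw [Matrix.map_mul, Matrix.map_mul, hadj, hM, hG, inv_def, Ring.inverse_eq_inv',
        smul_mul_assoc, smul_mul_assoc, smul_smul, mul_inv_cancel₀ hx, one_smul]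
    have h2 : MvPolynomial.eval x ((G.adjugate * M.map (MvPolynomial.C (σ := Fin n × Fin n)) * G) a.1 a.2) =
        (upperPart x).det * ((upperPart x)⁻¹ * M * upperPart x) a.1 a.2 :=
      congrFun (congrFun h1 a.1) a.2
    simp only [map_mul, h x hx, h2, MvPolynomial.eval_X]
    ring

/-- A polynomial that vanishes on all conjugates of a matrix by the Borel subgroup over an infinite
subfield also vanishes on those by upper triangular matrices over the field. -/
theorem eval_conj_eq_zero {K L : Type*} [Field K] [Infinite K] [Field L] [Algebra K L] {n : ℕ}
    (M : Matrix (Fin n) (Fin n) L) (p : MvPolynomial (Fin n × Fin n) L)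
    (hp : ∀ g ∈ borel n K, MvPolynomial.eval (fun a =>
      ((g⁻¹ : GL (Fin n) K).val.map (algebraMap K L) * M * g.val.map (algebraMap K L)) a.1 a.2)
        p = 0)
    {h g : Matrix (Fin n) (Fin n) L} (hg : g.BlockTriangular id) (hhg : h * g = 1) :
    MvPolynomial.eval (fun a => (h * M * g) a.1 a.2) p = 0 := by
  obtain ⟨N, P, hP⟩ := exists_eval_conj_upperPart M p
  -- Entries from `K`, nonzero on the diagonal so that the matrix lies in `B(K)`; the coordinates
  -- below the diagonal are ignored by `upperPart`. A polynomial vanishing on a product of infinite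
  -- sets is zero.
  let s : Fin n × Fin n → Set L := fun a =>
    algebraMap K L '' {k | a.1 = a.2 → k ≠ 0}
  have hs (a) : (s a).Infinite := by
    refine Set.Infinite.image (algebraMap K L).injective.injOn ?_
    refine Set.Infinite.mono (s := {0}ᶜ) (fun k hk _ => hk) ?_
    exact (Set.finite_singleton 0).infinite_compl
  have hP0 : P = 0 := by
    refine MvPolynomial.funext_set s hs fun x hx => ?_
    choose k hk hkx using fun a => hx a (Set.mem_univ a)
    have hx' : upperPart x = (upperPart k).map (algebraMap K L) := by
      rw [upperPart_map]
      congr 1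
      exact (funext hkx).symm
    have hdk : (upperPart k).det ≠ 0 := by
      rw [det_upperPart]
      exact Finset.prod_ne_zero_iff.2 fun l _ => hk (l, l) rfl
    let γ : GL (Fin n) K := GeneralLinearGroup.mkOfDetNeZero (upperPart k) hdk
    have hγ : γ.val = upperPart k := rfl
    have hmul : (γ⁻¹ : GL (Fin n) K).val.map (algebraMap K L) * upperPart x = 1 := by
      rw [hx', ← hγ, ← Matrix.map_mul, ← Units.val_mul, inv_mul_cancel, Units.val_one]
      exact Matrix.map_one _ (map_zero _) (map_one _)
    have hdx : (upperPart x).det ≠ 0 := by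
      have := congrArg det hmul
      rw [det_mul, det_one] at this
      exact right_ne_zero_of_mul (this ▸ one_ne_zero)
    rw [hP x hdx, inv_eq_left_inv hmul]
    have := hp γ (fun r c hrc => upperPart_blockTriangular k hrc)
    rw [hγ, ← hx'] at this
    rw [this, mul_zero, map_zero]
  have hdg : g.det ≠ 0 := by
    have := congrArg det hhg
    rw [det_mul, det_one] at this
    exact right_ne_zero_of_mul (this ▸ one_ne_zero)
  have h1 := hP (fun a => g a.1 a.2) (by rwa [upperPart_eq hg])
  rw [upperPart_eq hg, hP0, map_zero, inv_eq_left_inv hhg] at h1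
  exact (mul_eq_zero.1 h1.symm).resolve_left (pow_ne_zero _ hdg)

/-- A family that generates a rational function field and is indexed by the variables is
algebraically independent. -/
theorem algebraicIndependent_of_adjoin_eq_top {K : Type*} {ι : Type} [Field K] [Finite ι]
    (v : ι → FractionRing (MvPolynomial ι K))
    (hv : IntermediateField.adjoin K (Set.range v) = ⊤) : AlgebraicIndependent K v := by
  have halg : Algebra.IsAlgebraic (Algebra.adjoin K (Set.range v))
      (FractionRing (MvPolynomial ι K)) := by
    rw [← IntermediateField.isAlgebraic_adjoin_iff_top, hv, Algebra.isAlgebraic_iff_isIntegral]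
    exact Algebra.isIntegral_of_surjective IntermediateField.topEquiv.surjective
  refine (Algebra.IsAlgebraic.isTranscendenceBasis_of_lift_le_trdeg_of_finite K v ?_).1
  -- Only the lower bound on the transcendence degree is needed: the field is algebraic over the
  -- family, whose size is at most that degree.
  have h1 := lift_trdeg_le_of_injective
    (IsScalarTower.toAlgHom K (MvPolynomial ι K) (FractionRing (MvPolynomial ι K)))
    (IsFractionRing.injective _ _)
  rw [MvPolynomial.trdeg_of_isDomain] at h1
  simpa using h1

/-! ### Weights of `y_i` and `Y_{i,j}`, and the normal form over the generated field -/

section Field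

variable {L : Type*} [Field L] {n : ℕ}

/-- The value of `y_i` at a matrix. -/
def yVal (M : Matrix (Fin n) (Fin n) L) (i : ℕ) (hi : i ≤ n) : L :=
  if i = 1 then minorJ M i 0 hi else minorJ M i (i - 1) hi / minorJ M (i - 1) 0 (by omega)

/-- The value of `Y_{i,j}` at a matrix. -/
def YVal (M : Matrix (Fin n) (Fin n) L) (i j : ℕ) (hi : i ≤ n) (hj : j + 2 ≤ i) : L :=
  minorJ M i j hi * yVal M (n - i + j + 1) (by omega) /
    (minorJ M (i - 1) j (by omega) * yVal M i hi)

theorem lastProd_zero (t : ℕ → L) : lastProd n t 0 = 1 := by simp [lastProd]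

theorem lastProd_one (t : ℕ → L) : lastProd n t 1 = t (n - 1) := by simp [lastProd]

theorem yVal_conj {h g : Matrix (Fin n) (Fin n) L} (hh : h.BlockTriangular id)
    (hg : g.BlockTriangular id) (hgh : h * g = 1) {t : ℕ → L} (ht : ∀ k, t k ≠ 0)
    (htg : ∀ k : Fin n, g k k = t k) (M : Matrix (Fin n) (Fin n) L) {i : ℕ} (hi1 : 1 ≤ i)
    (hi : i ≤ n) : yVal (h * M * g) i hi = t (i - 1) / t (n - 1) * yVal M i hi := by
  obtain ⟨i, rfl⟩ := Nat.exists_eq_add_of_le' hi1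
  have hw {a b : ℕ} (hba : b ≤ a) (ha : a ≤ n) :=
    minorJ_conj_eq_weight hh hg hgh htg M hba ha
  rcases Nat.eq_zero_or_pos i with rfl | hi0
  · simp only [yVal, if_true, zero_add, hw (Nat.zero_le 1) hi, Finset.prod_range_one,
      lastProd_one, lastProd_zero, mul_one, Nat.sub_self, Nat.sub_zero]
  · rw [yVal, yVal, if_neg (by omega), if_neg (by omega), hw (by omega), hw (by omega)]
    have e1 : i + 1 - i = 1 := by omega
    simp only [Nat.add_sub_cancel, e1, lastProd_one, lastProd_zero, mul_one, Nat.sub_zero,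
      Finset.prod_range_succ]
    have h1 := lastProd_ne_zero (n := n) ht i
    have h2 : ∏ k ∈ Finset.range i, t k ≠ 0 := Finset.prod_ne_zero_iff.2 fun k _ => ht k
    have h3 := ht (n - 1)
    rw [mul_div_mul_comm]
    congr 1
    field_simp

/-- The quotient `J_{i,j} / J_{i-1,j}` has weight `t_{i-1} / t_{n-i+j}`, which is the inverse of the
weight of `y_{n-i+j+1} / y_i`. -/
theorem YVal_conj {h g : Matrix (Fin n) (Fin n) L} (hh : h.BlockTriangular id)
    (hg : g.BlockTriangular id) (hgh : h * g = 1) {t : ℕ → L} (ht : ∀ k, t k ≠ 0)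
    (htg : ∀ k : Fin n, g k k = t k) (M : Matrix (Fin n) (Fin n) L) {i j : ℕ} (hi : i ≤ n)
    (hj : j + 2 ≤ i) : YVal (h * M * g) i j hi hj = YVal M i j hi hj := by
  obtain ⟨a, rfl⟩ := Nat.exists_eq_add_of_le' hj
  have e0 : a + (j + 2) - 1 = a + (j + 1) := by omega
  have e1 : a + (j + 2) - j = a + 1 + 1 := by omega
  have e2 : a + (j + 1) - j = a + 1 := by omega
  have e3 : n - (a + (j + 2)) + j + 1 - 1 = n - (a + 1 + 1) := by omega
  rw [YVal, YVal, yVal_conj hh hg hgh ht htg _ (by omega), yVal_conj hh hg hgh ht htg _ (by omega),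
    minorJ_conj_eq_weight hh hg hgh htg M (by omega), minorJ_conj_eq_weight hh hg hgh htg M
    (by omega), e3]
  simp only [e0, e1, e2]
  rw [lastProd_succ (n := n) t (a := a + 1) (by omega),
    show ∏ k ∈ Finset.range (a + (j + 2)), t k = _ from Finset.prod_range_succ t (a + (j + 1))]
  have h1 := lastProd_ne_zero (n := n) ht (a + 1)
  have h2 := lastProd_ne_zero (n := n) ht j
  have h3 : ∏ k ∈ Finset.range (a + (j + 1)), t k ≠ 0 := Finset.prod_ne_zero_iff.2 fun k _ => ht k
  have h4 := ht (n - 1)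
  have h5 := ht (n - (a + 1 + 1))
  have h6 := ht (a + (j + 1))
  have key (A m B z C m' D z' : L) :
      A * m * (B * z) / (C * m' * (D * z')) = A * B / (C * D) * (m * z / (m' * z')) := by
    rw [mul_mul_mul_comm A, mul_mul_mul_comm C, mul_div_mul_comm]
  rw [key]
  convert! one_mul _ using 2
  field_simp

/-- Recursion on `i`: the definition of `Y_{i,j}` is solved for `J_{i,j}` when `j ≤ i - 2`, and that
of `y_i` for `J_{i,i-1}`. -/
theorem minorJ_mem_of_yVal_mem (F : Subfield L) {M : Matrix (Fin n) (Fin n) L}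
    (h0 : ∀ i j hi, j ≤ i → minorJ M i j hi ≠ 0) (hy : ∀ i hi, 1 ≤ i → yVal M i hi ∈ F)
    (hY : ∀ i j hi hj, YVal M i j hi hj ∈ F) (i j : ℕ) (hi : i ≤ n) (hj : j < i) :
    minorJ M i j hi ∈ F := by
  have hy0 (i : ℕ) (hi : i ≤ n) (hi1 : 1 ≤ i) : yVal M i hi ≠ 0 := by
    rw [yVal]
    split_ifs
    · exact h0 _ _ _ (by omega)
    · exact div_ne_zero (h0 _ _ _ (by omega)) (h0 _ _ _ (by omega))
  induction i generalizing j with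
  | zero => omega
  | succ i ih =>
    rcases Nat.eq_zero_or_pos i with rfl | hi0
    · obtain rfl : j = 0 := by omega
      simpa [yVal] using hy 1 hi le_rfl
    rcases Nat.lt_or_ge j i with hji | hji
    · have h1 := F.mul_mem (hY (i + 1) j hi (by omega)) (F.div_mem (F.mul_mem
        (ih j (by omega) hji) (hy (i + 1) hi (by omega)))
        (hy (n - (i + 1) + j + 1) (by omega) (by omega)))
      have h2 := hy0 (i + 1) hi (by omega)
      have h3 := hy0 (n - (i + 1) + j + 1) (by omega) (by omega)
      have h4 := h0 i j (by omega) hji.le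
      rw [YVal] at h1
      convert! h1 using 1
      simp only [Nat.add_sub_cancel]
      field_simp
    · obtain rfl : j = i := by omega
      have h1 := F.mul_mem (hy (j + 1) hi (by omega)) (ih 0 (by omega) hi0)
      rw [yVal, if_neg (by omega)] at h1
      simp only [Nat.add_sub_cancel] at h1
      rwa [div_mul_cancel₀ _ (h0 _ _ _ (by omega))] at h1

/-- The normal form of a generic matrix under conjugation by upper triangular matrices: its entries
are rational functions of `y_n` and the `Y_{i,j}`. -/
theorem exists_conj_mem (F : Subfield L) {M : Matrix (Fin n) (Fin n) L}
    (h0 : ∀ i j hi, j ≤ i → minorJ M i j hi ≠ 0) (hy : yVal M n le_rfl ∈ F)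
    (hY : ∀ i j hi hj, YVal M i j hi hj ∈ F) :
    ∃ h g : Matrix (Fin n) (Fin n) L, h.BlockTriangular id ∧ g.BlockTriangular id ∧ h * g = 1 ∧
      (∀ k : Fin n, (k : ℕ) + 1 = n → g k k = 1) ∧ ∀ r c, (h * M * g) r c ∈ F := by
  have hy0 (i : ℕ) (hi : i ≤ n) (hi1 : 1 ≤ i) : yVal M i hi ≠ 0 := by
    rw [yVal]
    split_ifs
    · exact h0 _ _ _ (by omega)
    · exact div_ne_zero (h0 _ _ _ (by omega)) (h0 _ _ _ (by omega))
  -- Chosen to make `y_i = 1` for `i < n`. Scalar matrices act trivially, so the last diagonal entry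
  -- may be `1`, and then `y_n` is unchanged.
  set t : ℕ → L := fun k => if hk : k + 1 < n then (yVal M (k + 1) hk.le)⁻¹ else 1 with htdef
  have ht (k : ℕ) : t k ≠ 0 := by
    simp only [htdef]
    split_ifs
    · exact inv_ne_zero (hy0 _ _ (by omega))
    · exact one_ne_zero
  have htlast : t (n - 1) = 1 := dif_neg (by omega)
  set D : Matrix (Fin n) (Fin n) L := diagonal fun k => t k
  set D' : Matrix (Fin n) (Fin n) L := diagonal fun k => (t k)⁻¹
  have hD : D.BlockTriangular id := blockTriangular_diagonal _
  have hD' : D'.BlockTriangular id := blockTriangular_diagonal _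
  have hDD : D' * D = 1 := by
    rw [diagonal_mul_diagonal, ← diagonal_one]
    congr 1
    funext k
    exact inv_mul_cancel₀ (ht k)
  have hconj0 {h g : Matrix (Fin n) (Fin n) L} (hh : h.BlockTriangular id)
      (hg : g.BlockTriangular id) (hgh : h * g = 1) (htg : ∀ k : Fin n, g k k = t k)
      (i j : ℕ) (hi : i ≤ n) (hj : j ≤ i) : minorJ (h * M * g) i j hi ≠ 0 := by
    rw [minorJ_conj_eq_weight hh hg hgh htg M hj hi]
    exact mul_ne_zero (div_ne_zero (Finset.prod_ne_zero_iff.2 fun k _ => ht k)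
      (mul_ne_zero (lastProd_ne_zero ht _) (lastProd_ne_zero ht _))) (h0 i j hi hj)
  obtain ⟨u, v, hu, hv, hvu, hu1, hS⟩ := exists_unitriangular_conj_upperLeft (D' * M * D)
    fun i hi => by
      rw [← minorJ_zero _ i (by omega)]
      exact hconj0 hD' hD hDD (fun k => diagonal_apply_eq _ _) i 0 _ (Nat.zero_le _)
  have hS' : v * (D' * M * D) * u = (v * D') * M * (D * u) := by simp only [mul_assoc]
  have hh : (v * D').BlockTriangular id := hv.mul hD'
  have hg : (D * u).BlockTriangular id := hD.mul hu
  have hhg : v * D' * (D * u) = 1 := by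
    rw [mul_assoc, ← mul_assoc D', hDD, one_mul, hvu]
  have htg (k : Fin n) : (D * u) k k = t k := by
    rw [diag_mul_of_blockTriangular hD hu, hu1, mul_one]
    exact diagonal_apply_eq _ _
  rw [hS'] at hS
  refine ⟨v * D', D * u, hh, hg, hhg, fun k hk => ?_, ?_⟩
  · rw [htg, ← htlast]
    congr 1
    omega
  · refine hS.forall_mem_of_minorJ_mem F (fun i j hi hj => hconj0 hh hg hhg htg i j hi hj.le) ?_
    refine minorJ_mem_of_yVal_mem F (hconj0 hh hg hhg htg) (fun i hi hi1 => ?_)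
      (fun i j hi hj => ?_)
    · rw [yVal_conj hh hg hhg ht htg M hi1, htlast, div_one]
      rcases hi.lt_or_eq with hin | rfl
      · have : t (i - 1) = (yVal M i hi)⁻¹ := by
          obtain ⟨i, rfl⟩ := Nat.exists_eq_add_of_le' hi1
          exact dif_pos hin
        rw [this, inv_mul_cancel₀ (hy0 i hi hi1)]
        exact F.one_mem
      · rw [htlast, one_mul]
        exact hy
    · rw [YVal_conj hh hg hhg ht htg M]
      exact hY i j hi hj

end Field

/-! ### The generic matrix: invariants and algebraic independence -/

/-- The generic matrix over the field of rational functions. -/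
noncomputable abbrev ratMatrix (n : ℕ) (K : Type*) [Field K] :
    Matrix (Fin n) (Fin n) (RatFun n K) :=
  (genericMatrix n K).map (algebraMap (PolyFun n K) (RatFun n K))

section

variable (n : ℕ) (K : Type*) [Field K]

theorem J_eq_minorJ (i j : ℕ) (hi : i ≤ n) : J n K i j hi = minorJ (ratMatrix n K) i j hi :=
  (minorJ_map _ _ _ _ _).symm

theorem y_eq_yVal (i : ℕ) (hi : i ≤ n) : y n K i hi = yVal (ratMatrix n K) i hi := by
  simp only [y, yVal, J_eq_minorJ]

theorem Y_eq_YVal (i j : ℕ) (hi : i ≤ n) (hj : j + 2 ≤ i) :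
    Y n K i j hi hj = YVal (ratMatrix n K) i j hi hj := by
  simp only [Y, YVal, y_eq_yVal, J_eq_minorJ]

theorem map_yVal {L L' : Type*} [Field L] [Field L'] (f : L →+* L')
    (M : Matrix (Fin n) (Fin n) L) (i : ℕ) (hi : i ≤ n) :
    f (yVal M i hi) = yVal (M.map f) i hi := by
  rw [yVal, yVal]
  split_ifs
  · rw [minorJ_map]
  · rw [map_div₀, minorJ_map, minorJ_map]

theorem map_YVal {L L' : Type*} [Field L] [Field L'] (f : L →+* L')
    (M : Matrix (Fin n) (Fin n) L) (i j : ℕ) (hi : i ≤ n) (hj : j + 2 ≤ i) :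
    f (YVal M i j hi hj) = YVal (M.map f) i j hi hj := by
  simp only [YVal, map_div₀, map_mul, map_yVal, minorJ_map]

variable {n K}

theorem map_adPolyHom (g : GL (Fin n) K) (p : PolyFun n K) :
    algebraMap (PolyFun n K) (RatFun n K) (adPolyHom n K g p) =
      MvPolynomial.aeval (fun a => ((g⁻¹ : GL (Fin n) K).val.map (algebraMap K (RatFun n K)) *
        ratMatrix n K * g.val.map (algebraMap K (RatFun n K))) a.1 a.2) p := by
  have hC (A : Matrix (Fin n) (Fin n) K) :
      (A.map MvPolynomial.C).map (algebraMap (PolyFun n K) (RatFun n K)) =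
        A.map (algebraMap K (RatFun n K)) := by
    ext r c
    exact (IsScalarTower.algebraMap_apply K (PolyFun n K) (RatFun n K) (A r c)).symm
  have hM : (conjGeneric n K g).map (algebraMap (PolyFun n K) (RatFun n K)) =
      (g⁻¹ : GL (Fin n) K).val.map (algebraMap K (RatFun n K)) *
        ratMatrix n K * g.val.map (algebraMap K (RatFun n K)) := by
    rw [conjGeneric, Matrix.map_mul, Matrix.map_mul, hC, hC]
  rw [← hM, adPolyHom, ← IsScalarTower.toAlgHom_apply K (PolyFun n K) (RatFun n K),
    ← AlgHom.comp_apply, MvPolynomial.comp_aeval]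
  rfl

theorem ratMatrix_map_adRat (g : GL (Fin n) K) :
    (ratMatrix n K).map (adRat n K g) = (g⁻¹ : GL (Fin n) K).val.map (algebraMap K (RatFun n K)) *
        ratMatrix n K * g.val.map (algebraMap K (RatFun n K)) := by
  ext r c
  have h := adRat_algebraMap n K g (MvPolynomial.X (r, c))
  rw [map_adPolyHom, MvPolynomial.aeval_X] at h
  exact h

theorem map_blockTriangular {g : GL (Fin n) K} (hg : g ∈ borel n K) (L : Type*) [Field L]
    [Algebra K L] : (g.val.map (algebraMap K L)).BlockTriangular id := by
  intro r c hrc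
  rw [map_apply, hg r c hrc, map_zero]

theorem map_inv_mul_map (g : GL (Fin n) K) (L : Type*) [Field L] [Algebra K L] :
    (g⁻¹ : GL (Fin n) K).val.map (algebraMap K L) * g.val.map (algebraMap K L) = 1 := by
  rw [← Matrix.map_mul, ← Units.val_mul, inv_mul_cancel, Units.val_one]
  exact Matrix.map_one _ (map_zero _) (map_one _)

theorem generators_mem_invariantField (hn : 1 ≤ n) (o : Option (YIndex n)) :
    generators n K o ∈ invariantField n K := by
  rw [invariantField, IntermediateField.mem_fixedField_iff]
  rintro _ ⟨g, hg, rfl⟩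
  have hg1 := map_blockTriangular hg (RatFun n K)
  have hh1 := map_blockTriangular (inv_mem hg) (RatFun n K)
  have hhg := map_inv_mul_map g (RatFun n K)
  set g' := g.val.map (algebraMap K (RatFun n K)) with hg'
  set h' := (g⁻¹ : GL (Fin n) K).val.map (algebraMap K (RatFun n K)) with hh'
  let t : ℕ → RatFun n K := fun k => if hk : k < n then g' ⟨k, hk⟩ ⟨k, hk⟩ else 1
  have htg (k : Fin n) : g' k k = t k := by simp [t]
  have ht (k : ℕ) : t k ≠ 0 := by
    simp only [t]
    split_ifs with hk
    · have := diag_mul_of_blockTriangular hh1 hg1 ⟨k, hk⟩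
      rw [hhg, one_apply_eq] at this
      exact right_ne_zero_of_mul (this ▸ one_ne_zero)
    · exact one_ne_zero
  have hmap : (ratMatrix n K).map (adRat n K g : RatFun n K →+* RatFun n K) =
      h' * ratMatrix n K * g' := ratMatrix_map_adRat g
  rcases o with _ | ⟨⟨i, j⟩, hi, hj⟩
  · change (adRat n K g : RatFun n K →+* RatFun n K) (y n K n le_rfl) = y n K n le_rfl
    rw [y_eq_yVal, map_yVal, hmap, yVal_conj hh1 hg1 hhg ht htg _ hn, div_self (ht _), one_mul]
  · change (adRat n K g : RatFun n K →+* RatFun n K) (Y n K i j hi hj) = Y n K i j hi hj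
    rw [Y_eq_YVal, map_YVal, hmap, YVal_conj hh1 hg1 hhg ht htg]

theorem aeval_mem_of_forall_mem {σ L : Type*} [Field L] [Algebra K L] (F : IntermediateField K L)
    {x : σ → L} (hx : ∀ a, x a ∈ F) (p : MvPolynomial σ K) : MvPolynomial.aeval x p ∈ F := by
  induction p using MvPolynomial.induction_on with
  | C a =>
    rw [MvPolynomial.aeval_C]
    exact F.algebraMap_mem a
  | add p q hp hq =>
    rw [map_add]
    exact F.add_mem hp hq
  | mul_X p a hp =>
    rw [map_mul, MvPolynomial.aeval_X]
    exact F.mul_mem hp (hx a)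

theorem aeval_ratMatrix (p : PolyFun n K) :
    MvPolynomial.aeval (fun a => ratMatrix n K a.1 a.2) p =
      algebraMap (PolyFun n K) (RatFun n K) p := by
  have h : IsScalarTower.toAlgHom K (PolyFun n K) (RatFun n K) =
      MvPolynomial.aeval (fun a => ratMatrix n K a.1 a.2) := by
    refine MvPolynomial.algHom_ext fun a => ?_
    simp
  rw [← h]
  rfl

theorem eq_top_of_ratMatrix_mem (F : IntermediateField K (RatFun n K))
    (hF : ∀ r c, ratMatrix n K r c ∈ F) : F = ⊤ := by
  refine eq_top_iff.2 fun f _ => ?_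
  obtain ⟨p, q, -, rfl⟩ := IsFractionRing.div_surjective (A := PolyFun n K) f
  rw [← aeval_ratMatrix, ← aeval_ratMatrix]
  exact F.div_mem (aeval_mem_of_forall_mem F (fun a => hF _ _) p)
    (aeval_mem_of_forall_mem F (fun a => hF _ _) q)

/-- An intermediate field that contains the entries of a matrix which is conjugate to the generic
matrix by an upper triangular matrix contains all invariants. -/
theorem invariantField_le_of_conj_mem [Infinite K] (F : IntermediateField K (RatFun n K))
    {h g : Matrix (Fin n) (Fin n) (RatFun n K)} (hh : h.BlockTriangular id)
    (hg : g.BlockTriangular id) (hhg : h * g = 1)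
    (hF : ∀ r c, (h * ratMatrix n K * g) r c ∈ F) : invariantField n K ≤ F := by
  intro f hf
  rw [invariantField, IntermediateField.mem_fixedField_iff] at hf
  obtain ⟨p, q, hq, rfl⟩ := IsFractionRing.div_surjective (A := PolyFun n K) f
  have hq0 : algebraMap (PolyFun n K) (RatFun n K) q ≠ 0 :=
    IsFractionRing.to_map_ne_zero_of_mem_nonZeroDivisors hq
  have hgh : g * h = 1 := mul_eq_one_comm.1 hhg
  have heval (x : Fin n × Fin n → RatFun n K) (p : PolyFun n K) :
      MvPolynomial.eval x (p.map (algebraMap K (RatFun n K))) = MvPolynomial.aeval x p := by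
    rw [MvPolynomial.eval_map, MvPolynomial.aeval_def]
  -- The denominator may vanish at the normal form itself. If it vanished at all its conjugates by
  -- `B(K)`, density would make it vanish at the generic matrix. Conjugating by `b` keeps the
  -- entries in `F`.
  obtain ⟨b, hb, hqb⟩ : ∃ b ∈ borel n K, MvPolynomial.aeval (fun a =>
      ((b⁻¹ : GL (Fin n) K).val.map (algebraMap K (RatFun n K)) * (h * ratMatrix n K * g) *
        b.val.map (algebraMap K (RatFun n K))) a.1 a.2) q ≠ 0 := by
    by_contra! hcon
    refine hq0 ?_
    have := eval_conj_eq_zero (K := K) (h * ratMatrix n K * g)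
      (q.map (algebraMap K (RatFun n K))) (fun b hb => by rw [heval]; exact hcon b hb) hh hgh
    have e : g * (h * ratMatrix n K * g) * h = ratMatrix n K := by
      calc g * (h * ratMatrix n K * g) * h = (g * h) * ratMatrix n K * (g * h) := by
            simp only [mul_assoc]
        _ = _ := by rw [hgh, one_mul, mul_one]
    rwa [e, heval, aeval_ratMatrix] at this
  set b' := b.val.map (algebraMap K (RatFun n K)) with hb'
  set c' := (b⁻¹ : GL (Fin n) K).val.map (algebraMap K (RatFun n K)) with hc'
  have hcb : c' * b' = 1 := map_inv_mul_map b (RatFun n K)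
  set S := c' * (h * ratMatrix n K * g) * b' with hSdef
  have hS : S = (c' * h) * ratMatrix n K * (g * b') := by simp only [hSdef, mul_assoc]
  have hSF (r c) : S r c ∈ F := by
    refine mul_mem_of_forall_mem F.toSubfield (mul_mem_of_forall_mem F.toSubfield ?_ hF) ?_ r c
    · exact fun r c => F.algebraMap_mem _
    · exact fun r c => F.algebraMap_mem _
  -- Invariance of `p / q` with denominators cleared: the polynomial `q(M) p - p(M) q` vanishes on
  -- all `B(K)`-conjugates of `M`, hence at `S`.
  have hinv := eval_conj_eq_zero (K := K) (ratMatrix n K)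
    (MvPolynomial.C (algebraMap (PolyFun n K) (RatFun n K) q) *
        p.map (algebraMap K (RatFun n K)) -
      MvPolynomial.C (algebraMap (PolyFun n K) (RatFun n K) p) *
        q.map (algebraMap K (RatFun n K)))
    (fun γ hγ => by
      have h1 := hf _ ⟨γ, hγ, rfl⟩
      have hγq : algebraMap (PolyFun n K) (RatFun n K) (adPolyHom n K γ q) ≠ 0 := by
        rw [← adRat_algebraMap]
        exact (map_ne_zero _).2 hq0
      rw [map_div₀, adRat_algebraMap, adRat_algebraMap, div_eq_div_iff hγq hq0] at h1
      rw [map_sub, map_mul, map_mul, MvPolynomial.eval_C, MvPolynomial.eval_C, heval, heval,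
        ← map_adPolyHom, ← map_adPolyHom]
      linear_combination h1)
    (h := c' * h) (g := g * b') (hg.mul (map_blockTriangular hb _))
    (by rw [mul_assoc, ← mul_assoc h, hhg, one_mul, hcb])
  rw [← hS, map_sub, map_mul, map_mul, MvPolynomial.eval_C, MvPolynomial.eval_C, heval, heval,
    sub_eq_zero] at hinv
  have hfin : algebraMap (PolyFun n K) (RatFun n K) p / algebraMap (PolyFun n K) (RatFun n K) q =
      MvPolynomial.aeval (fun a => S a.1 a.2) p / MvPolynomial.aeval (fun a => S a.1 a.2) q := by
    rw [div_eq_div_iff hq0 hqb]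
    linear_combination -hinv
  rw [hfin]
  exact F.div_mem (aeval_mem_of_forall_mem F (fun a => hSF _ _) p)
    (aeval_mem_of_forall_mem F (fun a => hSF _ _) q)

/-- The entry of an `n × n` array at which a generator is placed. -/
def generatorIndex (hn : 1 ≤ n) : Option (YIndex n) → Fin n × Fin n
  | none => (⟨n - 1, by omega⟩, ⟨n - 1, by omega⟩)
  | some p => (⟨p.1.1 - 1, by have := p.2; omega⟩, ⟨p.1.2, by have := p.2; omega⟩)

theorem generatorIndex_injective (hn : 1 ≤ n) : Function.Injective (generatorIndex hn) := by
  rintro (_ | ⟨⟨i, j⟩, hi, hj⟩) (_ | ⟨⟨i', j'⟩, hi', hj'⟩) h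
  · rfl
  · simp only [generatorIndex, Prod.mk.injEq, Fin.mk.injEq] at h hi' hj'
    omega
  · simp only [generatorIndex, Prod.mk.injEq, Fin.mk.injEq] at h hi hj
    omega
  · simp only [generatorIndex, Prod.mk.injEq, Fin.mk.injEq, Option.some.injEq,
      Subtype.mk.injEq] at h hi hj hi' hj' ⊢
    omega

theorem algebraicIndependent_generators (hn : 1 ≤ n)
    {h g : Matrix (Fin n) (Fin n) (RatFun n K)}
    (hg : g.BlockTriangular id) (hhg : h * g = 1) (hg1 : ∀ k : Fin n, (k : ℕ) + 1 = n → g k k = 1)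
    (hF : ∀ r c, (h * ratMatrix n K * g) r c ∈
      IntermediateField.adjoin K (Set.range (generators n K))) :
    AlgebraicIndependent K (generators n K) := by
  have hinj := generatorIndex_injective (n := n) hn
  -- The generators fill the places strictly below the diagonal and the bottom right corner; the
  -- entries of `g` fill the rest. The corner is free because `g` has a `1` there.
  set v : Fin n × Fin n → RatFun n K :=
    Function.extend (generatorIndex hn) (generators n K) fun a => g a.1 a.2 with hv
  have hvgen (o) : v (generatorIndex hn o) = generators n K o := hinj.extend_apply _ _ _
  suffices hind : AlgebraicIndependent K v by
    have := hind.comp _ hinj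
    rwa [show v ∘ generatorIndex hn = generators n K from funext hvgen] at this
  refine algebraicIndependent_of_adjoin_eq_top v (eq_top_of_ratMatrix_mem _ ?_)
  set E := IntermediateField.adjoin K (Set.range v)
  have hvE (a) : v a ∈ E := IntermediateField.subset_adjoin K _ ⟨a, rfl⟩
  have hle : IntermediateField.adjoin K (Set.range (generators n K)) ≤ E := by
    refine IntermediateField.adjoin_le_iff.2 ?_
    rintro _ ⟨o, rfl⟩
    rw [← hvgen]
    exact hvE _
  have hgE (r c) : g r c ∈ E := by
    rcases lt_or_ge c r with hcr | hcr
    · rw [hg hcr]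
      exact E.zero_mem
    by_cases hr : r = c ∧ (r : ℕ) + 1 = n
    · rw [← hr.1, hg1 r hr.2]
      exact E.one_mem
    have : v (r, c) = g r c := by
      refine Function.extend_apply' _ _ _ ?_
      rintro ⟨o, ho⟩
      rcases o with _ | ⟨⟨i, j⟩, hi, hj⟩
      · simp only [generatorIndex, Prod.mk.injEq] at ho
        refine hr ⟨ho.1.symm.trans ho.2, ?_⟩
        rw [← ho.1]
        simp only
        omega
      · simp only [generatorIndex, Prod.mk.injEq] at ho hi hj
        rw [← ho.1, ← ho.2, Fin.mk_le_mk] at hcr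
        omega
    rw [← this]
    exact hvE _
  have hhE (r c) : h r c ∈ E := by
    rw [← inv_eq_left_inv hhg]
    exact inv_mem_of_forall_mem E.toSubfield hgE r c
  have hgh : g * h = 1 := mul_eq_one_comm.1 hhg
  have e : g * (h * ratMatrix n K * g) * h = ratMatrix n K := by
    calc g * (h * ratMatrix n K * g) * h = (g * h) * ratMatrix n K * (g * h) := by
          simp only [mul_assoc]
      _ = _ := by rw [hgh, one_mul, mul_one]
  intro r c
  rw [← e]
  exact mul_mem_of_forall_mem E.toSubfield
    (mul_mem_of_forall_mem E.toSubfield hgE fun r c => hle (hF r c)) hhE r c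

end

end BorelInvariants

theorem theorem2p2 (K : Type*) [Field K] [CharZero K] (n : ℕ) (hn : 1 ≤ n) :
    (∀ (i j : ℕ) (hi : i ≤ n), j < i → BorelInvariants.J n K i j hi ≠ 0) ∧
    AlgebraicIndependent K (BorelInvariants.generators n K) ∧
    BorelInvariants.invariantField n K =
      IntermediateField.adjoin K (Set.range (BorelInvariants.generators n K)) := by
  set F := IntermediateField.adjoin K (Set.range (BorelInvariants.generators n K))
  have hF (o) : BorelInvariants.generators n K o ∈ F :=
    IntermediateField.subset_adjoin K _ ⟨o, rfl⟩
  obtain ⟨h, g, hh, hg, hhg, hg1, hM⟩ := BorelInvariants.exists_conj_mem F.toSubfield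
    (M := BorelInvariants.ratMatrix n K)
    (fun i j hi hj => by
      rw [← BorelInvariants.J_eq_minorJ]
      exact BorelInvariants.J_ne_zero n K i j hi hj)
    (by
      rw [← BorelInvariants.y_eq_yVal]
      exact hF none)
    (fun i j hi hj => by
      rw [← BorelInvariants.Y_eq_YVal]
      exact hF (some ⟨(i, j), hi, hj⟩))
  refine ⟨fun i j hi hj => BorelInvariants.J_ne_zero n K i j hi hj.le,
    BorelInvariants.algebraicIndependent_generators hn hg hhg hg1 hM, le_antisymm
      (BorelInvariants.invariantField_le_of_conj_mem F hh hg hhg hM)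
      (IntermediateField.adjoin_le_iff.2 ?_)⟩
  rintro _ ⟨o, rfl⟩
  exact BorelInvariants.generators_mem_invariantField hn o
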